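/- There are universal constants $C,c>0$ such that the following holds. Let $\mathbb K\in\{\mathbb R,\mathbb C\}$ and let $A\in\mathbb K^{m\times n}$ be a nonzero matrix with rank $k$, stable rank $r=\|A\|_F^2/\|A\|_2^2$, and condition number $\kappa(A)=\|A\|_2\|A^\dagger\|_2$, where $\|\cdot\|_2$ is the spectral norm, $\|\cdot\|_F$ the Frobenius norm and $\dagger$ the Moore–Penrose pseudoinverse. Put $p^{\rm col}_j=\|A(:,j)\|_2^2/\|A\|_F^2$ for $j\in[n]$ and $q^{\rm row}_i=\|A(i,:)\|_2^2/\|A\|_F^2$ for $i\in[m]$, where $[N]=\{1,\dots,N\}$. Let $\widetilde p$ and $\widetilde q$ be probability distributions on $[n]$ and $[m]$ with $$\widetilde p_j\ge\alpha_j^2\,p^{\rm col}_j\quad(j\in[n]),\qquad \widetilde q_i\ge\beta_i^2\,q^{\rm row}_i\quad(i\in[m])$$ for some constants $\alpha_j,\beta_i>0$, where $\alpha_j=1$ whenever $A(:,j)=0$ and $\beta_i=1$ whenever $A(i,:)=0$. Let $\alpha=\min_j\alpha_j$, $\beta=\min_i\beta_i$ and $\gamma=\min\{\alpha,\beta\}$.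 Let $\delta\in(0,1)$ and $0<\varepsilon<\min\{\kappa(A)^{-1},\,\delta^{-1/4}\sqrt{2\gamma}\}$, and let $d_1\in[m]$, $d_2\in[n]$ satisfy $$d_1,d_2\ \ge\ C\,\frac{r}{\varepsilon^4\delta}\log\Big(\frac{r}{\varepsilon^4\delta}\Big).$$ Choose row indices $I$ by $d_1$ independent draws with replacement from $\widetilde q$ and, independently, column indices $J$ by $d_2$ independent draws with replacement from $\widetilde p$. Set $C_J=A(:,J)$, $U=A(I,J)$, $R=A(I,:)$ (with repeated columns and rows retained). Then with probability at least $$\max\{0,\,1-2e^{-c\alpha^2/\delta}\}\cdot\max\{0,\,1-2e^{-c\beta^2/\delta}\}$$ one has $$\operatorname{rank}(U)=k\quad\text{and}\quad A=C_J\,U^\dagger R.$$ The same conclusion, with the same probability bound, holds if $I$ and $J$ are replaced by the sets $I_0$, $J_0$ of their distinct entries. -/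

import Mathlib

open scoped Matrix

/-- `X` is a Moore–Penrose pseudoinverse of `A`: the four Penrose equations hold. -/
structure IsMoorePenrose {𝕜 : Type*} [RCLike 𝕜] {m n : Type*} [Fintype m] [Fintype n]
    (A : Matrix m n 𝕜) (X : Matrix n m 𝕜) : Prop where
  mul_mul_self : A * X * A = A
  self_mul_mul : X * A * X = X
  isHermitian_left : (A * X).IsHermitian
  isHermitian_right : (X * A).IsHermitian

/-- Every matrix has a Moore–Penrose pseudoinverse. -/
theorem exists_isMoorePenrose {𝕜 : Type*} [RCLike 𝕜] {m n : Type*} [Fintype m] [Fintype n]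
    (A : Matrix m n 𝕜) : ∃ X : Matrix n m 𝕜, IsMoorePenrose A X := by
  classical
  have hH : (Aᴴ * A).IsHermitian := Matrix.isHermitian_conjTranspose_mul_self A
  obtain ⟨G, hG, hHGH, hGHG, hcomm⟩ : ∃ G : Matrix n n 𝕜, G.IsHermitian ∧
      (Aᴴ * A) * G * (Aᴴ * A) = Aᴴ * A ∧ G * (Aᴴ * A) * G = G ∧
      G * (Aᴴ * A) = (Aᴴ * A) * G := by
    set V : Matrix n n 𝕜 := (hH.eigenvectorUnitary : Matrix n n 𝕜) with hV
    have hVV : Vᴴ * V = 1 := by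
      rw [← Matrix.star_eq_conjTranspose]
      exact Unitary.coe_star_mul_self hH.eigenvectorUnitary
    set D : Matrix n n 𝕜 := Matrix.diagonal (fun i => ((hH.eigenvalues i : ℝ) : 𝕜)) with hD
    set D' : Matrix n n 𝕜 := Matrix.diagonal (fun i => (((hH.eigenvalues i)⁻¹ : ℝ) : 𝕜)) with hD'
    have hspec : Aᴴ * A = V * D * Vᴴ := by
      conv_lhs => rw [hH.spectral_theorem, Unitary.conjStarAlgAut_apply]
      rfl
    have hprod : ∀ M N : Matrix n n 𝕜, V * M * Vᴴ * (V * N * Vᴴ) = V * (M * N) * Vᴴ := by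
      intro M N
      calc V * M * Vᴴ * (V * N * Vᴴ) = V * M * (Vᴴ * V) * N * Vᴴ := by
            simp only [Matrix.mul_assoc]
        _ = V * (M * N) * Vᴴ := by rw [hVV, Matrix.mul_one]; simp only [Matrix.mul_assoc]
    have h1 : D * D' * D = D := by
      rw [hD, hD', Matrix.diagonal_mul_diagonal, Matrix.diagonal_mul_diagonal]
      congr 1
      funext i
      rw [← RCLike.ofReal_mul, ← RCLike.ofReal_mul, mul_inv_mul_cancel]
    have h2 : D' * D * D' = D' := by
      rw [hD, hD', Matrix.diagonal_mul_diagonal, Matrix.diagonal_mul_diagonal]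
      congr 1
      funext i
      rw [← RCLike.ofReal_mul, ← RCLike.ofReal_mul]
      congr 1
      rcases eq_or_ne (hH.eigenvalues i) 0 with h0 | h0
      · rw [h0]; simp
      · field_simp
    have h3 : D' * D = D * D' := by
      rw [hD, hD', Matrix.diagonal_mul_diagonal, Matrix.diagonal_mul_diagonal]
      congr 1
      funext i
      exact mul_comm _ _
    have h4 : D'ᴴ = D' := by
      rw [hD', Matrix.diagonal_conjTranspose]
      congr 1
      funext i
      simp
    refine ⟨V * D' * Vᴴ, ?_, ?_, ?_, ?_⟩
    · rw [Matrix.IsHermitian, Matrix.conjTranspose_mul, Matrix.conjTranspose_mul,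
        Matrix.conjTranspose_conjTranspose, h4, Matrix.mul_assoc]
    · rw [hspec, hprod, hprod, h1]
    · rw [hspec, hprod, hprod, h2]
    · rw [hspec, hprod, hprod, h3]
  have hA : A * G * (Aᴴ * A) = A := by
    have hz : (A * G * (Aᴴ * A) - A)ᴴ * (A * G * (Aᴴ * A) - A) = 0 := by
      have e1 : (A * G * (Aᴴ * A) - A)ᴴ * A = 0 := by
        rw [Matrix.conjTranspose_sub, Matrix.sub_mul, Matrix.conjTranspose_mul (A * G),
          Matrix.conjTranspose_mul A G, hG.eq, hH.eq]
        rw [show Aᴴ * A * (G * Aᴴ) * A = (Aᴴ * A) * G * (Aᴴ * A) by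
          simp only [Matrix.mul_assoc], hHGH, sub_self]
      have e2 : ∀ B : Matrix n n 𝕜, (A * G * (Aᴴ * A) - A)ᴴ * (A * B) = 0 := by
        intro B
        rw [← Matrix.mul_assoc, e1, Matrix.zero_mul]
      rw [Matrix.mul_sub, e1, sub_zero, Matrix.mul_assoc A G (Aᴴ * A)]
      have e3 := e2 (G * (Aᴴ * A))
      rwa [Matrix.mul_assoc A G (Aᴴ * A)] at e3
    open scoped ComplexOrder in
    exact sub_eq_zero.mp (Matrix.conjTranspose_mul_self_eq_zero.mp hz)
  refine ⟨G * Aᴴ, ?_, ?_, ?_, ?_⟩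
  · rw [← Matrix.mul_assoc, Matrix.mul_assoc (A * G), hA]
  · rw [Matrix.mul_assoc G, ← Matrix.mul_assoc (G * (Aᴴ * A)), hGHG]
  · rw [Matrix.IsHermitian, Matrix.conjTranspose_mul, Matrix.conjTranspose_mul,
      Matrix.conjTranspose_conjTranspose, hG.eq, Matrix.mul_assoc]
  · rw [Matrix.mul_assoc, Matrix.IsHermitian, Matrix.conjTranspose_mul, hG.eq, hH.eq, hcomm]

/-- The Moore–Penrose pseudoinverse is unique. -/
theorem IsMoorePenrose.unique {𝕜 : Type*} [RCLike 𝕜] {m n : Type*} [Fintype m] [Fintype n]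
    {A : Matrix m n 𝕜} {X Y : Matrix n m 𝕜} (hX : IsMoorePenrose A X) (hY : IsMoorePenrose A Y) :
    X = Y := by
  have h1 : A * X = A * Y := by
    calc A * X = (A * X)ᴴ := hX.isHermitian_left.eq.symm
      _ = ((A * Y) * (A * X))ᴴ := by
        rw [← Matrix.mul_assoc (A * Y) A X, hY.mul_mul_self]
      _ = (A * X) * (A * Y) := by
        rw [Matrix.conjTranspose_mul, hX.isHermitian_left.eq, hY.isHermitian_left.eq]
      _ = A * Y := by rw [← Matrix.mul_assoc, hX.mul_mul_self]
  have h2 : X * A = Y * A := by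
    calc X * A = (X * A)ᴴ := hX.isHermitian_right.eq.symm
      _ = ((X * A) * (Y * A))ᴴ := by
        rw [Matrix.mul_assoc X A (Y * A), ← Matrix.mul_assoc A Y A, hY.mul_mul_self]
      _ = (Y * A) * (X * A) := by
        rw [Matrix.conjTranspose_mul, hX.isHermitian_right.eq, hY.isHermitian_right.eq]
      _ = Y * A := by rw [Matrix.mul_assoc, ← Matrix.mul_assoc A X A, hX.mul_mul_self]
  calc X = X * A * X := hX.self_mul_mul.symm
    _ = Y * (A * X) := by rw [h2, Matrix.mul_assoc]
    _ = Y * A * Y := by rw [h1, Matrix.mul_assoc]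
    _ = Y := hY.self_mul_mul

/-- The Moore–Penrose pseudoinverse `A†`. -/
noncomputable def pinv {𝕜 : Type*} [RCLike 𝕜] {m n : Type*} [Fintype m] [Fintype n]
    (A : Matrix m n 𝕜) : Matrix n m 𝕜 :=
  Classical.choose (exists_isMoorePenrose A)

theorem isMoorePenrose_pinv {𝕜 : Type*} [RCLike 𝕜] {m n : Type*} [Fintype m] [Fintype n]
    (A : Matrix m n 𝕜) : IsMoorePenrose A (pinv A) :=
  Classical.choose_spec (exists_isMoorePenrose A)

/-- The spectral norm `‖A‖₂`, i.e. the operator norm of `x ↦ A x` for the Euclidean norms. -/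
noncomputable def specNorm {𝕜 : Type*} [RCLike 𝕜] {m n : ℕ} (A : Matrix (Fin m) (Fin n) 𝕜) : ℝ :=
  ‖LinearMap.toContinuousLinearMap (Matrix.toEuclideanLin A)‖

/-- The squared Frobenius norm `‖A‖_F²`. -/
noncomputable def frobSq {𝕜 : Type*} [RCLike 𝕜] {m n : ℕ} (A : Matrix (Fin m) (Fin n) 𝕜) : ℝ :=
  ∑ i, ∑ j, ‖A i j‖ ^ 2

/-- The stable rank `‖A‖_F² / ‖A‖₂²`. -/
noncomputable def stableRank {𝕜 : Type*} [RCLike 𝕜] {m n : ℕ} (A : Matrix (Fin m) (Fin n) 𝕜) : ℝ :=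
  frobSq A / specNorm A ^ 2

/-- The generalized spectral condition number `κ(A) = ‖A‖₂ ‖A†‖₂`. -/
noncomputable def condNumber {𝕜 : Type*} [RCLike 𝕜] {m n : ℕ} (A : Matrix (Fin m) (Fin n) 𝕜) : ℝ :=
  specNorm A * specNorm (pinv A)

/-- The column-length distribution `p_j = ‖A(:,j)‖₂² / ‖A‖_F²`. -/
noncomputable def colProb {𝕜 : Type*} [RCLike 𝕜] {m n : ℕ} (A : Matrix (Fin m) (Fin n) 𝕜)
    (j : Fin n) : ℝ :=
  (∑ i, ‖A i j‖ ^ 2) / frobSq A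

/-- The row-length distribution `q_i = ‖A(i,:)‖₂² / ‖A‖_F²`. -/
noncomputable def rowProb {𝕜 : Type*} [RCLike 𝕜] {m n : ℕ} (A : Matrix (Fin m) (Fin n) 𝕜)
    (i : Fin m) : ℝ :=
  (∑ j, ‖A i j‖ ^ 2) / frobSq A

/-- For (families of) row indices `I` and column indices `J`, with
`C = A(:,J)`, `U = A(I,J)`, `R = A(I,:)`: `rank U = rank A` and `A = C U† R`. -/
def IsExactCUR {𝕜 : Type*} [RCLike 𝕜] {m n : ℕ} (A : Matrix (Fin m) (Fin n) 𝕜)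
    {s t : Type*} [Fintype s] [Fintype t] (I : s → Fin m) (J : t → Fin n) : Prop :=
  (A.submatrix I J).rank = A.rank ∧
    A = A.submatrix id J * pinv (A.submatrix I J) * A.submatrix I id

/-- The law of `d` independent draws with replacement from the distribution `p`. -/
noncomputable def iidLaw {N : ℕ} (d : ℕ) (p : PMF (Fin N)) : MeasureTheory.Measure (Fin d → Fin N) :=
  MeasureTheory.Measure.pi (fun _ => p.toMeasure)

/-- The joint law of the row indices and the column indices: `d₁` i.i.d. draws from `q` and,
independently, `d₂` i.i.d. draws from `p`. -/
noncomputable def samplingLaw {m n : ℕ} (d₁ d₂ : ℕ) (q : PMF (Fin m)) (p : PMF (Fin n)) :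
    MeasureTheory.Measure ((Fin d₁ → Fin m) × (Fin d₂ → Fin n)) :=
  (iidLaw d₁ q).prod (iidLaw d₂ p)

/-- The inclusion of the set of distinct indices occurring in the sample `I`
(i.e. the sample without repeated entries). -/
def distinctIdx {N d : ℕ} (I : Fin d → Fin N) :
    {i : Fin N // i ∈ Finset.univ.image I} → Fin N :=
  Subtype.val

/-! ### Span of randomly drawn vectors in a finite-dimensional inner product space. -/

section RandomSpan

open Module Submodule

variable {𝕜 E ι : Type*} [RCLike 𝕜] [NormedAddCommGroup E] [InnerProductSpace 𝕜 E]
  [FiniteDimensional 𝕜 E] [Fintype ι]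

/-! The equality `A = C U† R` is purely algebraic once the drawn columns span the column space and
the drawn rows span the row space (`isExactCUR_of_spans`). By independence, and since rows are
handled as columns of `Aᴴ`, it remains to bound the probability that the drawn columns fail to span.

No matrix concentration is needed. If the columns drawn so far span `V`, the columns outside `V`
have total squared length at least `codim V / ‖A†‖₂²`, by the lower frame bound and Bessel's
inequality. With `a = ⨅ j, α j`, each draw therefore shrinks the expected codimension by the factor
`1 - θ`, where `θ = a² / (r κ²)` (`sum_mul_codim_sup_le`, `expected_codim_span_le`). Codimension is
an integer, so Markov's inequality bounds the failure probability by `k exp(-θ d)`. Finally `ε κ <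
1` and `k ≤ r κ²` make the prescribed `d` large enough. -/

open Classical in
/-- If the vectors `a j` satisfy a lower frame bound on their span, then the vectors outside a
subspace `V` of the span carry at least a mass proportional to the codimension of `V`. -/
theorem codim_le_mul_sum_norm_sq_notMem (a : ι → E) {K : ℝ}
    (hK : ∀ u ∈ span 𝕜 (Set.range a), ‖u‖ ^ 2 ≤ K * ∑ j, ‖inner 𝕜 (a j) u‖ ^ 2)
    (hK0 : 0 ≤ K) {V : Submodule 𝕜 E} (hV : V ≤ span 𝕜 (Set.range a)) :
    (finrank 𝕜 (span 𝕜 (Set.range a)) : ℝ) - finrank 𝕜 V ≤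
      K * ∑ j, if a j ∈ V then 0 else ‖a j‖ ^ 2 := by
  -- The frame bound is summed over an orthonormal basis of `S`, whose dimension is the codimension.
  -- Vectors `a j ∈ V` are orthogonal to `S` and drop out; the others obey Bessel's inequality.
  set S : Submodule 𝕜 E := Vᗮ ⊓ span 𝕜 (Set.range a) with hS
  have hdim := finrank_add_inf_finrank_orthogonal hV
  rw [← hS] at hdim
  set b := stdOrthonormalBasis 𝕜 S
  have hb : Orthonormal 𝕜 (fun i => (b i : E)) := b.orthonormal.comp_linearIsometry S.subtypeₗᵢ
  have h1 : ∀ i, 1 ≤ K * ∑ j, ‖inner 𝕜 (a j) (b i : E)‖ ^ 2 := fun i => by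
    have := hK (b i) (b i).2.2
    rwa [hb.1 i, one_pow] at this
  calc (finrank 𝕜 (span 𝕜 (Set.range a)) : ℝ) - finrank 𝕜 V = ∑ _i : Fin (finrank 𝕜 S), 1 := by
        rw [← hdim]; simp
    _ ≤ ∑ i, K * ∑ j, ‖inner 𝕜 (a j) (b i : E)‖ ^ 2 := Finset.sum_le_sum fun i _ => h1 i
    _ = K * ∑ j, ∑ i, ‖inner 𝕜 (b i : E) (a j)‖ ^ 2 := by
        rw [← Finset.mul_sum, Finset.sum_comm]
        simp_rw [norm_inner_symm]
    _ ≤ K * ∑ j, if a j ∈ V then 0 else ‖a j‖ ^ 2 := by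
        refine mul_le_mul_of_nonneg_left (Finset.sum_le_sum fun j _ => ?_) hK0
        split_ifs with hj
        · refine (Finset.sum_eq_zero fun i _ => ?_).le
          rw [inner_left_of_mem_orthogonal hj (b i).2.1, norm_zero, zero_pow two_ne_zero]
        · exact hb.sum_inner_products_le (a j)

/-- One draw decreases the expected codimension of the span by a constant factor. -/
theorem sum_mul_codim_sup_le (a : ι → E) {K θ η : ℝ} (w : ι → ℝ)
    (hK : ∀ u ∈ span 𝕜 (Set.range a), ‖u‖ ^ 2 ≤ K * ∑ j, ‖inner 𝕜 (a j) u‖ ^ 2)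
    (hK0 : 0 ≤ K) (hθ : 0 ≤ θ) (hη : θ * K ≤ η) (hw0 : ∀ j, 0 ≤ w j) (hw1 : ∑ j, w j = 1)
    (hw : ∀ j, η * ‖a j‖ ^ 2 ≤ w j) {V : Submodule 𝕜 E} (hV : V ≤ span 𝕜 (Set.range a)) :
    ∑ j, w j * ((finrank 𝕜 (span 𝕜 (Set.range a)) : ℝ) - finrank 𝕜 (span 𝕜 {a j} ⊔ V : Submodule 𝕜 E)) ≤
      (1 - θ) * ((finrank 𝕜 (span 𝕜 (Set.range a)) : ℝ) - finrank 𝕜 V) := by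
  classical
  set k : ℝ := (finrank 𝕜 (span 𝕜 (Set.range a)) : ℝ)
  have hstep : ∀ j, w j * (k - finrank 𝕜 (span 𝕜 {a j} ⊔ V : Submodule 𝕜 E)) ≤
      w j * (k - finrank 𝕜 V) - if a j ∈ V then 0 else w j := fun j => by
    split_ifs with hj
    · rw [sup_eq_right.2 ((span_singleton_le_iff_mem _ _).2 hj), sub_zero]
    · have hlt : V < span 𝕜 {a j} ⊔ V := lt_of_le_not_ge le_sup_right fun h =>
        hj (h (mem_sup_left (mem_span_singleton_self _)))
      have h1 : (finrank 𝕜 V : ℝ) + 1 ≤ finrank 𝕜 (span 𝕜 {a j} ⊔ V : Submodule 𝕜 E) := by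
        exact_mod_cast finrank_lt_finrank_of_lt hlt
      nlinarith [hw0 j]
  have hmass : θ * (k - finrank 𝕜 V) ≤ ∑ j, if a j ∈ V then 0 else w j :=
    calc θ * (k - finrank 𝕜 V) ≤ θ * (K * ∑ j, if a j ∈ V then 0 else ‖a j‖ ^ 2) :=
          mul_le_mul_of_nonneg_left (codim_le_mul_sum_norm_sq_notMem a hK hK0 hV) hθ
      _ ≤ η * ∑ j, if a j ∈ V then 0 else ‖a j‖ ^ 2 := by
          rw [← mul_assoc]
          refine mul_le_mul_of_nonneg_right hη (Finset.sum_nonneg fun j _ => ?_)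
          split_ifs <;> positivity
      _ ≤ ∑ j, if a j ∈ V then 0 else w j := by
          rw [Finset.mul_sum]
          refine Finset.sum_le_sum fun j _ => ?_
          split_ifs
          · simp
          · exact hw j
  calc _ ≤ ∑ j, (w j * (k - finrank 𝕜 V) - if a j ∈ V then 0 else w j) :=
        Finset.sum_le_sum fun j _ => hstep j
    _ = (k - finrank 𝕜 V) - ∑ j, if a j ∈ V then 0 else w j := by
        rw [Finset.sum_sub_distrib, ← Finset.sum_mul, hw1, one_mul]
    _ ≤ _ := by linarith

/-- The expected codimension of the span of `d` independent draws decays exponentially in `d`. -/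
theorem expected_codim_span_le (a : ι → E) {K θ η : ℝ} (w : ι → ℝ)
    (hK : ∀ u ∈ span 𝕜 (Set.range a), ‖u‖ ^ 2 ≤ K * ∑ j, ‖inner 𝕜 (a j) u‖ ^ 2)
    (hK0 : 0 ≤ K) (hθ : 0 ≤ θ) (hη : θ * K ≤ η) (hw0 : ∀ j, 0 ≤ w j) (hw1 : ∑ j, w j = 1)
    (hw : ∀ j, η * ‖a j‖ ^ 2 ≤ w j) (d : ℕ) :
    ∑ J : Fin d → ι, (∏ i, w (J i)) * ((finrank 𝕜 (span 𝕜 (Set.range a)) : ℝ) -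
        finrank 𝕜 (span 𝕜 (Set.range (a ∘ J)))) ≤
      finrank 𝕜 (span 𝕜 (Set.range a)) * Real.exp (-(θ * d)) := by
  have hle : ∀ {d : ℕ} (J : Fin d → ι), span 𝕜 (Set.range (a ∘ J)) ≤ span 𝕜 (Set.range a) :=
    fun J => span_mono (Set.range_comp_subset_range J a)
  have hexp : 1 - θ ≤ Real.exp (-θ) := by linarith [Real.add_one_le_exp (-θ)]
  induction d with
  | zero => simp
  | succ d ih =>
    -- Split off one coordinate of `J`; the inner sum over it is a single draw added to the span of
    -- the others.
    rw [← (Fin.consEquiv fun _ => ι).sum_comp, Fintype.sum_prod_type_right]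
    calc _ = ∑ J : Fin d → ι, (∏ i, w (J i)) * ∑ j, w j *
            ((finrank 𝕜 (span 𝕜 (Set.range a)) : ℝ) -
              finrank 𝕜 (span 𝕜 {a j} ⊔ span 𝕜 (Set.range (a ∘ J)) : Submodule 𝕜 E)) := by
          refine Finset.sum_congr rfl fun J _ => ?_
          rw [Finset.mul_sum]
          refine Finset.sum_congr rfl fun j _ => ?_
          have hspan : span 𝕜 (Set.range (a ∘ Fin.consEquiv (fun _ => ι) (j, J))) =
              span 𝕜 {a j} ⊔ span 𝕜 (Set.range (a ∘ J)) := by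
            rw [← span_insert, Set.range_comp a J, ← Set.image_insert_eq, ← Fin.range_cons,
              ← Set.range_comp]
            rfl
          rw [hspan, Fin.prod_univ_succ]
          simp only [Fin.consEquiv, Equiv.coe_fn_mk, Fin.cons_zero, Fin.cons_succ]
          ring
      _ ≤ ∑ J : Fin d → ι, (∏ i, w (J i)) * (Real.exp (-θ) *
            ((finrank 𝕜 (span 𝕜 (Set.range a)) : ℝ) -
              finrank 𝕜 (span 𝕜 (Set.range (a ∘ J))))) := by
          refine Finset.sum_le_sum fun J _ => mul_le_mul_of_nonneg_left ?_
            (Finset.prod_nonneg fun i _ => hw0 _)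
          refine (sum_mul_codim_sup_le a w hK hK0 hθ hη hw0 hw1 hw (hle J)).trans
            (mul_le_mul_of_nonneg_right hexp ?_)
          exact sub_nonneg.2 (by exact_mod_cast finrank_mono (hle J))
      _ = Real.exp (-θ) * ∑ J : Fin d → ι, (∏ i, w (J i)) *
            ((finrank 𝕜 (span 𝕜 (Set.range a)) : ℝ) -
              finrank 𝕜 (span 𝕜 (Set.range (a ∘ J)))) := by
          rw [Finset.mul_sum]
          exact Finset.sum_congr rfl fun J _ => by ring
      _ ≤ Real.exp (-θ) * (finrank 𝕜 (span 𝕜 (Set.range a)) * Real.exp (-(θ * d))) :=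
          mul_le_mul_of_nonneg_left ih (Real.exp_nonneg _)
      _ = _ := by
          rw [mul_left_comm, ← Real.exp_add]
          push_cast
          ring_nf

end RandomSpan

/-! ### From expected codimension to the probability of spanning. -/

section Sampling

open Module Submodule MeasureTheory

instance isProbabilityMeasure_iidLaw {N d : ℕ} (p : PMF (Fin N)) :
    IsProbabilityMeasure (iidLaw d p) := by
  unfold iidLaw; infer_instance

theorem iidLaw_real_singleton {N d : ℕ} (p : PMF (Fin N)) (J : Fin d → Fin N) :
    (iidLaw d p).real {J} = ∏ i, (p (J i)).toReal := by
  simp [iidLaw, measureReal_def, Measure.pi_singleton, ENNReal.toReal_prod]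

theorem PMF.sum_toReal_eq_one {ι : Type*} [Fintype ι] (p : PMF ι) : ∑ j, (p j).toReal = 1 := by
  rw [← ENNReal.toReal_sum fun j _ => p.apply_ne_top j, ← tsum_fintype (L := .unconditional _),
    p.tsum_coe, ENNReal.toReal_one]

/-- Markov's inequality: on the failure event the codimension is a positive integer, hence at least
1, so that event has probability at most the expected codimension. -/
theorem one_sub_le_iidLaw_span_eq {𝕜 E : Type*} [RCLike 𝕜] [NormedAddCommGroup E]
    [InnerProductSpace 𝕜 E] [FiniteDimensional 𝕜 E] {N : ℕ} (a : Fin N → E) {K θ η : ℝ}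
    (p : PMF (Fin N))
    (hK : ∀ u ∈ span 𝕜 (Set.range a), ‖u‖ ^ 2 ≤ K * ∑ j, ‖inner 𝕜 (a j) u‖ ^ 2)
    (hK0 : 0 ≤ K) (hθ : 0 ≤ θ) (hη : θ * K ≤ η)
    (hp : ∀ j, η * ‖a j‖ ^ 2 ≤ (p j).toReal) (d : ℕ) :
    1 - finrank 𝕜 (span 𝕜 (Set.range a)) * Real.exp (-(θ * d)) ≤
      (iidLaw d p).real {J | span 𝕜 (Set.range (a ∘ J)) = span 𝕜 (Set.range a)} := by
  classical
  have hmain := expected_codim_span_le a (fun j => (p j).toReal) hK hK0 hθ hη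
    (fun _ => ENNReal.toReal_nonneg) p.sum_toReal_eq_one hp d
  set G := {J : Fin d → Fin N | span 𝕜 (Set.range (a ∘ J)) = span 𝕜 (Set.range a)} with hG
  have hGm : MeasurableSet G := (Set.toFinite G).measurableSet
  have hc : (iidLaw d p).real Gᶜ ≤ finrank 𝕜 (span 𝕜 (Set.range a)) * Real.exp (-(θ * d)) := by
    refine le_trans ?_ hmain
    rw [← Set.coe_toFinset Gᶜ, ← sum_measureReal_singleton]
    simp_rw [iidLaw_real_singleton]
    refine le_trans (Finset.sum_le_sum (g := fun J => (∏ i, (p (J i)).toReal) *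
      ((finrank 𝕜 (span 𝕜 (Set.range a)) : ℝ) - finrank 𝕜 (span 𝕜 (Set.range (a ∘ J)))))
      fun J hJ => ?_) (Finset.sum_le_sum_of_subset_of_nonneg (Finset.subset_univ _)
        fun J _ _ => ?_)
    · have hlt : span 𝕜 (Set.range (a ∘ J)) < span 𝕜 (Set.range a) :=
        lt_of_le_of_ne (span_mono (Set.range_comp_subset_range J a)) (by simpa [hG] using hJ)
      have h1 : (finrank 𝕜 (span 𝕜 (Set.range (a ∘ J))) : ℝ) + 1 ≤
          finrank 𝕜 (span 𝕜 (Set.range a)) := by exact_mod_cast finrank_lt_finrank_of_lt hlt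
      exact le_mul_of_one_le_right (Finset.prod_nonneg fun i _ => ENNReal.toReal_nonneg)
        (by linarith)
    · refine mul_nonneg (Finset.prod_nonneg fun i _ => ENNReal.toReal_nonneg) (sub_nonneg.2 ?_)
      exact_mod_cast finrank_mono (span_mono (Set.range_comp_subset_range J a))
  have := probReal_add_probReal_compl (μ := iidLaw d p) hGm
  linarith

end Sampling

/-! ### Spanning rows and columns give an exact CUR decomposition. -/

section CUR

variable {𝕜 : Type*} [RCLike 𝕜] {m n : ℕ}

/-- The `j`-th column of `A` as a vector of the Euclidean space. -/
noncomputable def euclideanCol (A : Matrix (Fin m) (Fin n) 𝕜) (j : Fin n) :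
    EuclideanSpace 𝕜 (Fin m) :=
  WithLp.toLp 2 fun i => A i j

/-- The columns of `A` with indices in `J` span the column space of `A`. -/
def SpansColumns (A : Matrix (Fin m) (Fin n) 𝕜) {t : Type*} (J : t → Fin n) : Prop :=
  Submodule.span 𝕜 (Set.range (euclideanCol A ∘ J)) =
    Submodule.span 𝕜 (Set.range (euclideanCol A))

theorem SpansColumns.exists_eq_mul {A : Matrix (Fin m) (Fin n) 𝕜} {t : Type*} [Fintype t]
    {J : t → Fin n} (h : SpansColumns A J) : ∃ Y : Matrix t (Fin n) 𝕜, A = A.submatrix id J * Y := by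
  have hex : ∀ j, ∃ y : t → 𝕜, ∑ l, y l • (euclideanCol A ∘ J) l = euclideanCol A j := fun j =>
    (Submodule.mem_span_range_iff_exists_fun 𝕜).1 (h ▸ Submodule.subset_span (Set.mem_range_self j))
  choose y hy using hex
  refine ⟨Matrix.of fun l j => y j l, ?_⟩
  ext i j
  have := congrArg (fun v : EuclideanSpace 𝕜 (Fin m) => v i) (hy j)
  simp only [Function.comp, WithLp.ofLp_sum, WithLp.ofLp_smul, Finset.sum_apply, Pi.smul_apply,
    euclideanCol, smul_eq_mul] at this
  simp [Matrix.mul_apply, ← this, mul_comm]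

theorem spansColumns_distinctIdx {A : Matrix (Fin m) (Fin n) 𝕜} {d : ℕ} {J : Fin d → Fin n} :
    SpansColumns A (distinctIdx J) ↔ SpansColumns A J := by
  have : Set.range (distinctIdx J) = Set.range J := by
    ext j; simp [distinctIdx]
  rw [SpansColumns, SpansColumns, Set.range_comp, Set.range_comp, this]

/-- Spanning yields `C = Zᴴ U`, `R = U Y` and `A = Zᴴ U Y`. The last factorization forces the rank,
and `C U† R = Zᴴ (U U† U) Y = A` uses only the first Penrose equation. -/
theorem isExactCUR_of_spans {A : Matrix (Fin m) (Fin n) 𝕜} {s t : Type*} [Fintype s] [Fintype t]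
    {I : s → Fin m} {J : t → Fin n} (hI : SpansColumns Aᴴ I) (hJ : SpansColumns A J) :
    IsExactCUR A I J := by
  obtain ⟨Y, hY⟩ := hJ.exists_eq_mul
  obtain ⟨Z, hZ⟩ := hI.exists_eq_mul
  have hX : A = Zᴴ * A.submatrix I id := by
    have := congrArg Matrix.conjTranspose hZ
    rwa [Matrix.conjTranspose_mul, Matrix.conjTranspose_submatrix,
      Matrix.conjTranspose_conjTranspose] at this
  have hC : A.submatrix id J = Zᴴ * A.submatrix I J := by
    conv_lhs => rw [hX]
    rfl
  have hR : A.submatrix I id = A.submatrix I J * Y := by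
    conv_lhs => rw [hY]
    rfl
  have hA : A = Zᴴ * A.submatrix I J * Y := by rw [← hC, ← hY]
  refine ⟨le_antisymm (Matrix.rank_submatrix_le A I J) ?_, ?_⟩
  · conv_lhs => rw [hA]
    exact (Matrix.rank_mul_le_left _ _).trans (Matrix.rank_mul_le_right _ _)
  · rw [hC, hR, Matrix.mul_assoc Zᴴ, Matrix.mul_assoc Zᴴ, ← Matrix.mul_assoc _ _ Y,
      (isMoorePenrose_pinv _).mul_mul_self, ← Matrix.mul_assoc, ← hA]

end CUR

/-! ### Norm identities, invariance under conjugate transpose, and the frame bound for columns. -/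

section Norms

variable {𝕜 : Type*} [RCLike 𝕜] {m n : ℕ}

theorem specNorm_nonneg (A : Matrix (Fin m) (Fin n) 𝕜) : 0 ≤ specNorm A := norm_nonneg _

open scoped Matrix.Norms.L2Operator in
theorem specNorm_conjTranspose (A : Matrix (Fin m) (Fin n) 𝕜) : specNorm Aᴴ = specNorm A :=
  Matrix.l2_opNorm_conjTranspose A

open scoped Matrix.Norms.L2Operator in
theorem specNorm_mul_le {l : ℕ} (A : Matrix (Fin m) (Fin n) 𝕜) (B : Matrix (Fin n) (Fin l) 𝕜) :
    specNorm (A * B) ≤ specNorm A * specNorm B :=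
  Matrix.l2_opNorm_mul A B

open scoped Matrix.Norms.L2Operator in
theorem norm_toLp_mulVec_le (A : Matrix (Fin m) (Fin n) 𝕜) (x : Fin n → 𝕜) :
    ‖(WithLp.toLp 2 (A *ᵥ x) : EuclideanSpace 𝕜 (Fin m))‖ ≤
      specNorm A * ‖(WithLp.toLp 2 x : EuclideanSpace 𝕜 (Fin n))‖ :=
  Matrix.l2_opNorm_mulVec A (WithLp.toLp 2 x)

open scoped Matrix.Norms.L2Operator in
theorem specNorm_pos {A : Matrix (Fin m) (Fin n) 𝕜} (hA : A ≠ 0) : 0 < specNorm A :=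
  show 0 < ‖A‖ from norm_pos_iff.2 hA

theorem pinv_conjTranspose (A : Matrix (Fin m) (Fin n) 𝕜) : pinv Aᴴ = (pinv A)ᴴ := by
  have h := isMoorePenrose_pinv A
  refine (isMoorePenrose_pinv Aᴴ).unique ⟨?_, ?_, ?_, ?_⟩
  · rw [← Matrix.conjTranspose_mul, ← Matrix.conjTranspose_mul, ← Matrix.mul_assoc,
      h.mul_mul_self]
  · rw [← Matrix.conjTranspose_mul, ← Matrix.conjTranspose_mul, ← Matrix.mul_assoc,
      h.self_mul_mul]
  · rw [← Matrix.conjTranspose_mul]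
    exact h.isHermitian_right.conjTranspose
  · rw [← Matrix.conjTranspose_mul]
    exact h.isHermitian_left.conjTranspose

theorem condNumber_conjTranspose (A : Matrix (Fin m) (Fin n) 𝕜) :
    condNumber Aᴴ = condNumber A := by
  rw [condNumber, condNumber, pinv_conjTranspose, specNorm_conjTranspose, specNorm_conjTranspose]

theorem frobSq_conjTranspose (A : Matrix (Fin m) (Fin n) 𝕜) : frobSq Aᴴ = frobSq A := by
  simp only [frobSq, Matrix.conjTranspose_apply, norm_star]
  exact Finset.sum_comm

theorem stableRank_conjTranspose (A : Matrix (Fin m) (Fin n) 𝕜) :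
    stableRank Aᴴ = stableRank A := by
  rw [stableRank, stableRank, frobSq_conjTranspose, specNorm_conjTranspose]

theorem colProb_conjTranspose (A : Matrix (Fin m) (Fin n) 𝕜) (i : Fin m) :
    colProb Aᴴ i = rowProb A i := by
  simp only [colProb, rowProb, frobSq_conjTranspose, Matrix.conjTranspose_apply, norm_star]

theorem one_le_condNumber {A : Matrix (Fin m) (Fin n) 𝕜} (hA : A ≠ 0) : 1 ≤ condNumber A := by
  have h0 := specNorm_pos hA
  have h : specNorm A ≤ specNorm A * specNorm (pinv A) * specNorm A := by
    conv_lhs => rw [← (isMoorePenrose_pinv A).mul_mul_self]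
    exact (specNorm_mul_le _ _).trans
      (mul_le_mul_of_nonneg_right (specNorm_mul_le _ _) h0.le)
  exact le_of_mul_le_mul_right (by rwa [one_mul]) h0

theorem norm_euclideanCol_sq (A : Matrix (Fin m) (Fin n) 𝕜) (j : Fin n) :
    ‖euclideanCol A j‖ ^ 2 = ∑ i, ‖A i j‖ ^ 2 := by
  rw [EuclideanSpace.norm_sq_eq]; rfl

theorem sum_norm_euclideanCol_sq (A : Matrix (Fin m) (Fin n) 𝕜) :
    ∑ j, ‖euclideanCol A j‖ ^ 2 = frobSq A := by
  simp only [norm_euclideanCol_sq, frobSq]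
  exact Finset.sum_comm

theorem frobSq_pos {A : Matrix (Fin m) (Fin n) 𝕜} (hA : A ≠ 0) : 0 < frobSq A := by
  obtain ⟨i, j, hij⟩ : ∃ i j, A i j ≠ 0 := by
    by_contra! h
    exact hA (Matrix.ext h)
  have h0 : 0 < ‖A i j‖ ^ 2 := by positivity
  refine h0.trans_le ((Finset.single_le_sum (f := fun j => ‖A i j‖ ^ 2)
    (fun _ _ => by positivity) (Finset.mem_univ j)).trans ?_)
  exact Finset.single_le_sum (f := fun i => ∑ j, ‖A i j‖ ^ 2)
    (fun _ _ => by positivity) (Finset.mem_univ i)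

theorem sum_colProb {A : Matrix (Fin m) (Fin n) 𝕜} (hA : A ≠ 0) : ∑ j, colProb A j = 1 := by
  simp only [colProb, ← norm_euclideanCol_sq]
  rw [← Finset.sum_div, sum_norm_euclideanCol_sq, div_self (frobSq_pos hA).ne']

/-- The columns of `A` satisfy a lower frame bound on the column space, with constant `‖A†‖₂²`. -/
theorem norm_sq_le_specNorm_pinv_sq_mul (A : Matrix (Fin m) (Fin n) 𝕜)
    {u : EuclideanSpace 𝕜 (Fin m)} (hu : u ∈ Submodule.span 𝕜 (Set.range (euclideanCol A))) :
    ‖u‖ ^ 2 ≤ specNorm (pinv A) ^ 2 * ∑ j, ‖inner 𝕜 (euclideanCol A j) u‖ ^ 2 := by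
  obtain ⟨y, hy⟩ := (Submodule.mem_span_range_iff_exists_fun 𝕜).1 hu
  have hAy : u.ofLp = A *ᵥ y := by
    ext i
    simp [← hy, euclideanCol, Matrix.mulVec, dotProduct, mul_comm]
  have hP := isMoorePenrose_pinv A
  -- `A A†` is Hermitian and fixes the range of `A`, so `(A†)ᴴ Aᴴ u = u`; the entries of `Aᴴ u` are
  -- the inner products with the columns.
  have hfix : (pinv A)ᴴ *ᵥ (Aᴴ *ᵥ u.ofLp) = u.ofLp := by
    rw [Matrix.mulVec_mulVec, ← Matrix.conjTranspose_mul, hP.isHermitian_left.eq, hAy,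
      Matrix.mulVec_mulVec, hP.mul_mul_self]
  have hbound := norm_toLp_mulVec_le (pinv A)ᴴ (Aᴴ *ᵥ u.ofLp)
  rw [hfix, specNorm_conjTranspose] at hbound
  have hsum : ‖(WithLp.toLp 2 (Aᴴ *ᵥ u.ofLp) : EuclideanSpace 𝕜 (Fin n))‖ ^ 2 =
      ∑ j, ‖inner 𝕜 (euclideanCol A j) u‖ ^ 2 := by
    rw [EuclideanSpace.norm_sq_eq]
    refine Finset.sum_congr rfl fun j _ => ?_
    simp [euclideanCol, Matrix.mulVec, dotProduct, PiLp.inner_apply, RCLike.inner_apply, mul_comm]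
  rw [← hsum, ← mul_pow]
  exact pow_le_pow_left₀ (norm_nonneg _) hbound 2

theorem stableRank_mul_condNumber_sq {A : Matrix (Fin m) (Fin n) 𝕜} (hA : A ≠ 0) :
    stableRank A * condNumber A ^ 2 = specNorm (pinv A) ^ 2 * frobSq A := by
  have := (specNorm_pos hA).ne'
  rw [stableRank, condNumber]
  field_simp

end Norms

/-! ### Choice of constants and the final assembly. -/

/-- The exponent `log k - L y` is at most `(1 - x) log T`, and `log T ≥ 1`: the logarithm in the
sample size absorbs the dimension factor `k`. -/
theorem exp_tail_le {x L k T y : ℝ} (hx : 4 ≤ x) (hk : 0 < k) (hkT : k ≤ T) (hT : 4 ≤ T)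
    (hL : x ≤ L * T) (hy : T * Real.log T ≤ y) (hL0 : 0 ≤ L) :
    k * Real.exp (-(L * y)) ≤ 2 * Real.exp (-(1 / 8 * x)) := by
  have hlog : 1 ≤ Real.log T := by
    rw [Real.le_log_iff_exp_le (by linarith)]
    linarith [Real.exp_one_lt_d9]
  have h1 : x * Real.log T ≤ L * y :=
    (mul_le_mul_of_nonneg_right hL (by linarith)).trans
      (by rw [mul_assoc]; exact mul_le_mul_of_nonneg_left hy hL0)
  have h2 : Real.log k ≤ Real.log T := Real.log_le_log hk hkT
  calc k * Real.exp (-(L * y)) = Real.exp (Real.log k - L * y) := by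
        rw [sub_eq_add_neg, Real.exp_add, Real.exp_log hk]
    _ ≤ Real.exp (-(1 / 8 * x)) := Real.exp_le_exp.2 (by nlinarith)
    _ ≤ _ := by linarith [Real.exp_pos (-(1 / 8 * x))]

theorem le_iidLaw_spansColumns {𝕜 : Type*} [RCLike 𝕜] {m n : ℕ} {A : Matrix (Fin m) (Fin n) 𝕜}
    (hA : A ≠ 0) (p : PMF (Fin n)) {α : Fin n → ℝ} (hα : ∀ j, 0 < α j)
    (hp : ∀ j, α j ^ 2 * colProb A j ≤ (p j).toReal) {δ ε : ℝ} (hδ0 : 0 < δ) (hδ1 : δ < 1)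
    (hε0 : 0 < ε) (hε : ε < (condNumber A)⁻¹) {d : ℕ}
    (hd : stableRank A / (ε ^ 4 * δ) * Real.log (stableRank A / (ε ^ 4 * δ)) ≤ d) :
    max 0 (1 - 2 * Real.exp (-(1 / 8 * (⨅ j, α j) ^ 2 / δ))) ≤
      (iidLaw d p).real {J | SpansColumns A J} := by
  refine max_le MeasureTheory.measureReal_nonneg ?_
  set a := ⨅ j, α j with ha
  have ha0 : 0 ≤ a := Real.iInf_nonneg fun j => (hα j).le
  have haα : ∀ j, a ≤ α j := fun j => ciInf_le (Set.finite_range α).bddBelow j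
  have hF := frobSq_pos hA
  have hcol0 : ∀ j, 0 ≤ colProb A j := fun j => by unfold colProb; positivity
  have hp' : ∀ j, a ^ 2 * colProb A j ≤ (p j).toReal := fun j =>
    (mul_le_mul_of_nonneg_right (pow_le_pow_left₀ ha0 (haα j) 2) (hcol0 j)).trans (hp j)
  -- Sum over `j`: both distributions have total mass 1.
  have ha1 : a ^ 2 ≤ 1 := by
    have := Finset.sum_le_sum fun j (_ : j ∈ Finset.univ) => hp' j
    rwa [← Finset.mul_sum, sum_colProb hA, mul_one, p.sum_toReal_eq_one] at this
  rw [mul_div_assoc]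
  -- Below 4 the claimed bound is nonpositive, since `exp (-x/8) ≥ 1 - x/8 > 1/2`; this is where the
  -- constant `1/8` comes from.
  rcases lt_or_ge (a ^ 2 / δ) 4 with hx | hx
  · have h1 : -(1 / 8 * (a ^ 2 / δ)) + 1 ≤ Real.exp (-(1 / 8 * (a ^ 2 / δ))) :=
      Real.add_one_le_exp _
    exact le_trans (by linarith) MeasureTheory.measureReal_nonneg
  set k : ℝ := (Module.finrank 𝕜 (Submodule.span 𝕜 (Set.range (euclideanCol A))) : ℝ) with hk
  set κ := condNumber A with hκ
  set r := stableRank A with hr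
  have hκ1 : 1 ≤ κ := one_le_condNumber hA
  have hrκ := stableRank_mul_condNumber_sq hA
  rw [← hr, ← hκ] at hrκ
  have hK : ∀ u ∈ Submodule.span 𝕜 (Set.range (euclideanCol A)), ‖u‖ ^ 2 ≤
      specNorm (pinv A) ^ 2 * ∑ j, ‖inner 𝕜 (euclideanCol A j) u‖ ^ 2 :=
    fun u hu => norm_sq_le_specNorm_pinv_sq_mul A hu
  -- The codimension estimate at `V = ⊥`, with `r κ² = ‖A†‖₂² ‖A‖_F²`.
  have hkrκ : k ≤ r * κ ^ 2 := by
    have h := codim_le_mul_sum_norm_sq_notMem (euclideanCol A) hK (sq_nonneg _)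
      (V := ⊥) bot_le
    rw [finrank_bot, Nat.cast_zero, sub_zero] at h
    rw [hrκ, ← sum_norm_euclideanCol_sq]
    refine h.trans (mul_le_mul_of_nonneg_left (Finset.sum_le_sum fun j _ => ?_) (sq_nonneg _))
    split_ifs <;> first | positivity | exact le_rfl
  have hk1 : 1 ≤ k := by
    rw [hk, Nat.one_le_cast, Nat.one_le_iff_ne_zero, Ne, Submodule.finrank_eq_zero,
      Submodule.span_eq_bot]
    intro h
    refine hF.ne' ?_
    rw [← sum_norm_euclideanCol_sq]
    exact Finset.sum_eq_zero fun j _ => by rw [h _ (Set.mem_range_self j)]; simp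
  have hrκ0 : 0 < r * κ ^ 2 := by linarith
  have hr0 : 0 < r := pos_of_mul_pos_left hrκ0 (sq_nonneg _)
  set T := r / (ε ^ 4 * δ) with hT
  have hεκ : ε ^ 4 * κ ^ 2 ≤ 1 := by
    have h1 : ε * κ ≤ 1 := by
      rw [lt_inv_comm₀ hε0 (by linarith)] at hε
      calc ε * κ ≤ ε * ε⁻¹ := mul_le_mul_of_nonneg_left hε.le hε0.le
        _ = 1 := mul_inv_cancel₀ hε0.ne'
    have h2 : ε ≤ 1 := by nlinarith
    calc ε ^ 4 * κ ^ 2 = ε ^ 2 * (ε * κ) ^ 2 := by ring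
      _ ≤ 1 * 1 := by gcongr <;> exact pow_le_one₀ (by positivity) (by assumption)
      _ = 1 := one_mul 1
  have hTge : r * κ ^ 2 / δ ≤ T := by
    rw [hT, div_le_div_iff₀ hδ0 (by positivity)]
    have : r * κ ^ 2 * (ε ^ 4 * δ) = (ε ^ 4 * κ ^ 2) * (r * δ) := by ring
    rw [this]
    exact mul_le_of_le_one_left (by positivity) hεκ
  -- Here `4 δ ≤ a² ≤ 1 ≤ k ≤ r κ²`.
  have hT4 : 4 ≤ T := by
    rw [le_div_iff₀ hδ0] at hx
    refine le_trans ?_ hTge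
    rw [le_div_iff₀ hδ0]
    linarith
  have hkT : k ≤ T := hkrκ.trans (le_trans (le_div_self hrκ0.le hδ0 hδ1.le) hTge)
  -- The largest `θ` with `θ ‖A†‖₂² ≤ a² / ‖A‖_F²`, the contraction rate that the sampling weights
  -- allow.
  set θ := a ^ 2 / (r * κ ^ 2) with hθ
  have hθ0 : 0 ≤ θ := by positivity
  have hθT : a ^ 2 / δ ≤ θ * T :=
    calc a ^ 2 / δ = θ * (r * κ ^ 2 / δ) := by rw [hθ]; field_simp
      _ ≤ θ * T := mul_le_mul_of_nonneg_left hTge hθ0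
  have hη : θ * specNorm (pinv A) ^ 2 ≤ a ^ 2 / frobSq A := by
    rw [le_div_iff₀ hF, mul_assoc, ← hrκ, hθ, div_mul_cancel₀ _ hrκ0.ne']
  have hmain := one_sub_le_iidLaw_span_eq (euclideanCol A) p hK (sq_nonneg _) hθ0 hη
    (fun j => by
      rw [norm_euclideanCol_sq, div_mul_eq_mul_div, mul_div_assoc]
      exact hp' j) d
  refine le_trans ?_ hmain
  have := exp_tail_le hx (by linarith) hkT hT4 hθT hd hθ0
  linarith

theorem mul_le_samplingLaw_isExactCUR {𝕜 : Type*} [RCLike 𝕜] {m n d₁ d₂ : ℕ}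
    {A : Matrix (Fin m) (Fin n) 𝕜} {q : PMF (Fin m)} {p : PMF (Fin n)} {x y : ℝ} (hy0 : 0 ≤ y)
    (hx : x ≤ (iidLaw d₂ p).real {J | SpansColumns A J})
    (hy : y ≤ (iidLaw d₁ q).real {I | SpansColumns Aᴴ I})
    {S : Set ((Fin d₁ → Fin m) × (Fin d₂ → Fin n))}
    (hS : ∀ ω, SpansColumns Aᴴ ω.1 → SpansColumns A ω.2 → ω ∈ S) :
    x * y ≤ (samplingLaw d₁ d₂ q p).real S := by
  have : MeasureTheory.IsProbabilityMeasure (samplingLaw d₁ d₂ q p) := by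
    unfold samplingLaw; infer_instance
  calc x * y ≤ (iidLaw d₂ p).real {J | SpansColumns A J} *
          (iidLaw d₁ q).real {I | SpansColumns Aᴴ I} :=
        mul_le_mul hx hy hy0 MeasureTheory.measureReal_nonneg
    _ = (samplingLaw d₁ d₂ q p).real ({I | SpansColumns Aᴴ I} ×ˢ {J | SpansColumns A J}) := by
        rw [samplingLaw, MeasureTheory.measureReal_prod_prod, mul_comm]
    _ ≤ _ := MeasureTheory.measureReal_mono fun ω hω => hS ω hω.1 hω.2

theorem mainTheorem1 :
    ∃ C c : ℝ, 0 < C ∧ 0 < c ∧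
      ∀ (𝕜 : Type) [RCLike 𝕜] (m n : ℕ) (A : Matrix (Fin m) (Fin n) 𝕜), A ≠ 0 →
      ∀ (q : PMF (Fin m)) (p : PMF (Fin n)) (β : Fin m → ℝ) (α : Fin n → ℝ),
        (∀ i, 0 < β i) → (∀ j, 0 < α j) →
        (∀ i, (∀ j, A i j = 0) → β i = 1) → (∀ j, (∀ i, A i j = 0) → α j = 1) →
        (∀ i, β i ^ 2 * rowProb A i ≤ (q i).toReal) →
        (∀ j, α j ^ 2 * colProb A j ≤ (p j).toReal) →
      ∀ δ ε : ℝ, 0 < δ → δ < 1 → 0 < ε →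
        ε < min (condNumber A)⁻¹
          (δ ^ (-(1 / 4) : ℝ) * √(2 * min (⨅ j, α j) (⨅ i, β i))) →
      ∀ d₁ ∈ Finset.Icc 1 m, ∀ d₂ ∈ Finset.Icc 1 n,
        C * (stableRank A / (ε ^ 4 * δ) * Real.log (stableRank A / (ε ^ 4 * δ))) ≤ d₁ →
        C * (stableRank A / (ε ^ 4 * δ) * Real.log (stableRank A / (ε ^ 4 * δ))) ≤ d₂ →
        max 0 (1 - 2 * Real.exp (-(c * (⨅ j, α j) ^ 2 / δ))) *
              max 0 (1 - 2 * Real.exp (-(c * (⨅ i, β i) ^ 2 / δ))) ≤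
            (samplingLaw d₁ d₂ q p).real {ω | IsExactCUR A ω.1 ω.2} ∧
        max 0 (1 - 2 * Real.exp (-(c * (⨅ j, α j) ^ 2 / δ))) *
              max 0 (1 - 2 * Real.exp (-(c * (⨅ i, β i) ^ 2 / δ))) ≤
            (samplingLaw d₁ d₂ q p).real
              {ω | IsExactCUR A (distinctIdx ω.1) (distinctIdx ω.2)} := by
  refine ⟨1, 1 / 8, one_pos, by norm_num, ?_⟩
  intro 𝕜 _ m n A hA q p β α hβ hα _ _ hq hp δ ε hδ0 hδ1 hε0 hε d₁ _ d₂ _ hd₁ hd₂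
  rw [one_mul] at hd₁ hd₂
  have hε' := hε.trans_le (min_le_left _ _)
  have hJ := le_iidLaw_spansColumns hA p hα hp hδ0 hδ1 hε0 hε' hd₂
  have hI := le_iidLaw_spansColumns (A := Aᴴ) (d := d₁) (by simpa using hA) q hβ
    (by simpa only [colProb_conjTranspose] using hq) hδ0 hδ1 hε0
    (by rwa [condNumber_conjTranspose]) (by rwa [stableRank_conjTranspose])
  exact ⟨mul_le_samplingLaw_isExactCUR (le_max_left _ _) hJ hI fun _ h₁ h₂ =>
      isExactCUR_of_spans h₁ h₂,
    mul_le_samplingLaw_isExactCUR (le_max_left _ _) hJ hI fun _ h₁ h₂ =>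
      isExactCUR_of_spans (spansColumns_distinctIdx.2 h₁) (spansColumns_distinctIdx.2 h₂)⟩
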